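/- All simplicial complexes are finite and abstract. A face of $K$ is \emph{free} if it is nonempty and properly contained in exactly one face of $K$; an \emph{elementary collapse} deletes a free face together with the unique face that properly contains it. $K$ is \emph{collapsible} if some finite sequence of elementary collapses reduces it to a single vertex, and \emph{extendably collapsible} if every complex obtained from $K$ by a finite (possibly empty) sequence of elementary collapses is collapsible, i.e. if every sequence of collapses can be continued to a point. $K$ is \emph{$\mathbb{Z}_2$-acyclic} if its reduced simplicial homology with coefficients in $\mathbb{Z}_2$ vanishes in all dimensions $\ge -1$ (so $K$ is nonempty). The algorithm \emph{Random Discrete Morse} takes a $d$-dimensional complex $K$, starts with $c_0=c_1=\dots=c_d=0$, and repeats the following until the complex is empty. If the current complex, of dimension $i$ say, has free faces of dimension $i-1$ (the empty face is not counted), pick one of them uniformly at random and delete it together with the unique face that properly contains it. Otherwise, pick one of the $i$-dimensional faces uniformly at random, delete it, and increase $c_i$ by $1$. The output is the discrete Morse vector $(c_0,c_1,\dots,c_d)$. The \emph{discrete Morse spectrum} $\sigma$ of $K$ is the probability distribution of the output. For connected $K$, the \emph{normalized discrete Morse spectrum} $\sigma_N$ is the image of $\sigma$ under $(c_0,c_1,c_2,\dots,c_d)\mapsto(1,c_1-c_0+1,c_2,\dots,c_d)$.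 Let $c_\sigma$ and $c^N_\sigma$ be the expected values of the sum of the entries of a vector distributed according to $\sigma$ and $\sigma_N$, respectively. \textbf{Corollary.} Let $K$ be a $\mathbb{Z}_2$-acyclic simplicial complex with at most $7$ vertices, and let $d=\dim K$. Then $K$ is extendably collapsible. Moreover, its discrete Morse spectrum is trivial: Random Discrete Morse returns the vector $(1,0,\dots,0)$, with $d+1$ entries, with probability $1$. Consequently, $c_\sigma=c^N_\sigma=1$. -/

import Mathlib

/-- A finite abstract simplicial complex on a vertex type `V`: a finite family of nonempty finite
subsets of `V` (the faces) that is closed under taking nonempty subsets. The vertices are those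
`v : V` for which `{v}` is a face; elements of `V` need not be vertices. -/
structure FinSimplicialComplex (V : Type*) extends PreAbstractSimplicialComplex V where
  finite_faces : faces.Finite

namespace FinSimplicialComplex

variable {V : Type*}

/-- The vertex set. -/
def vertices (K : FinSimplicialComplex V) : Set V := {v | {v} ∈ K.faces}

/-- The faces, as a finset. -/
noncomputable def faceFinset (K : FinSimplicialComplex V) : Finset (Finset V) :=
  K.finite_faces.toFinset

/-- The dimension (a face `s` has dimension `s.card - 1`). The empty complex gets the value `0`. -/
noncomputable def dim (K : FinSimplicialComplex V) : ℕ :=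
  K.faceFinset.sup fun s => s.card - 1

section Homology

/-- The faces with exactly `n` vertices (so of dimension `n - 1`), where for `n = 0`
the empty set is counted as the unique face of dimension `-1`. -/
def AugFace (K : FinSimplicialComplex V) (n : ℕ) : Type _ :=
  {s : Finset V // s.card = n ∧ (s = ∅ ∨ s ∈ K.faces)}

/-- The augmented simplicial chains of dimension `n - 1` with coefficients in `ℤ/2`. -/
abbrev Chain (K : FinSimplicialComplex V) (n : ℕ) : Type _ := K.AugFace n →₀ ZMod 2

open Classical in
/-- The face of `s` opposite to its vertex `v`. -/
noncomputable def AugFace.opposite {K : FinSimplicialComplex V} {n : ℕ} (s : K.AugFace (n + 1))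
    (v : {v : V // v ∈ s.1}) : K.AugFace n :=
  ⟨s.1.erase v.1, by
    have h := s.2
    refine ⟨by rw [Finset.card_erase_of_mem v.2, h.1]; rfl, ?_⟩
    rcases h.2 with h0 | h0
    · exact absurd v.2 (by simp [h0])
    · rcases (s.1.erase v.1).eq_empty_or_nonempty with he | he
      · exact Or.inl he
      · exact Or.inr ((K.isRelLowerSet_faces h0).2 (Finset.erase_subset _ _) he)⟩

/-- The mod 2 boundary operator, which sends `a • s`, for a face `s` and `a : ℤ/2`, to the sum of
`a • t` over the codimension-one faces `t` of `s`. The case `n = 0` is the augmentation map. -/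
noncomputable def boundary (K : FinSimplicialComplex V) (n : ℕ) : K.Chain (n + 1) →+ K.Chain n :=
  Finsupp.liftAddHom fun s : K.AugFace (n + 1) =>
    ∑ v : {v : V // v ∈ s.1}, Finsupp.singleAddHom (s.opposite v)

/-- The cycles of dimension `n - 1`. -/
noncomputable def cycles (K : FinSimplicialComplex V) : (n : ℕ) → AddSubgroup (K.Chain n)
  | 0 => ⊤
  | n + 1 => (K.boundary n).ker

/-- The boundaries of dimension `n - 1`. -/
noncomputable def boundaries (K : FinSimplicialComplex V) (n : ℕ) : AddSubgroup (K.Chain n) :=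
  (K.boundary n).range

/-- The reduced simplicial homology group of dimension `n - 1` with coefficients in `ℤ/2`:
cycles modulo boundaries. -/
abbrev reducedHomology (K : FinSimplicialComplex V) (n : ℕ) : Type _ :=
  K.cycles n ⧸ (K.boundaries n).addSubgroupOf (K.cycles n)

/-- `K` is `ℤ/2`-acyclic: its reduced homology with coefficients in `ℤ/2` vanishes in all
dimensions, including dimension `-1` (so the empty complex is not acyclic). -/
def IsZ2Acyclic (K : FinSimplicialComplex V) : Prop :=
  ∀ n : ℕ, Subsingleton (K.reducedHomology n)

end Homology

section Collapse

/-- `s` is a free face of `K`: it is a (nonempty) face properly contained in exactly one face. -/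
def IsFree (K : FinSimplicialComplex V) (s : Finset V) : Prop :=
  s ∈ K.faces ∧ ∃! t, t ∈ K.faces ∧ s ⊂ t

/-- The complex obtained by deleting `s` and all faces that contain `s`. If `s` is free these are
`s` and the unique face properly containing it; if `s` is a maximal face it is `s` alone. -/
def deleteFace (K : FinSimplicialComplex V) (s : Finset V) : FinSimplicialComplex V where
  faces := {u | u ∈ K.faces ∧ ¬ s ⊆ u}
  isRelLowerSet_faces := by
    rintro u ⟨hu, hsu⟩
    refine ⟨(K.isRelLowerSet_faces hu).1, fun w hw hne => ⟨(K.isRelLowerSet_faces hu).2 hw hne, ?_⟩⟩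
    exact fun h => hsu (h.trans hw)
  finite_faces := K.finite_faces.subset fun _ h => h.1

theorem deleteFace_faces_of_isFree {K : FinSimplicialComplex V} {s t : Finset V}
    (hs : K.IsFree s) (ht : t ∈ K.faces) (hst : s ⊂ t) :
    (K.deleteFace s).faces = K.faces \ {s, t} := by
  obtain ⟨_, t', _, h⟩ := hs
  have h1 : t = t' := h t ⟨ht, hst⟩
  subst h1
  ext u
  simp only [deleteFace, Set.mem_ofPred_eq, Set.mem_sdiff, Set.mem_insert_iff,
    Set.mem_singleton_iff, not_or]
  refine and_congr_right fun hu => ⟨fun h2 => ⟨?_, ?_⟩, fun h2 h3 => ?_⟩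
  · rintro rfl; exact h2 subset_rfl
  · rintro rfl; exact h2 hst.subset
  · exact h2.2 (h u ⟨hu, h3.ssubset_of_ne (Ne.symm h2.1)⟩)

/-- `L` arises from `K` by an elementary collapse: the deletion of a free face together with the
unique face that properly contains it. -/
def ElementaryCollapse (K L : FinSimplicialComplex V) : Prop :=
  ∃ s, K.IsFree s ∧ L = K.deleteFace s

/-- `K` collapses onto `L` by a finite, possibly empty, sequence of elementary collapses. -/
def CollapsesTo (K L : FinSimplicialComplex V) : Prop :=
  Relation.ReflTransGen ElementaryCollapse K L

/-- `K` consists of a single vertex. -/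
def IsPoint (K : FinSimplicialComplex V) : Prop := ∃ v : V, K.faces = {{v}}

/-- `K` collapses to a point. -/
def IsCollapsible (K : FinSimplicialComplex V) : Prop := ∃ L, K.CollapsesTo L ∧ L.IsPoint

/-- Every sequence of elementary collapses starting at `K` can be continued to a point. -/
def IsExtendablyCollapsible (K : FinSimplicialComplex V) : Prop :=
  ∀ L, K.CollapsesTo L → L.IsCollapsible

end Collapse

section RandomDiscreteMorse

open Classical in
/-- The top-dimensional faces. -/
noncomputable def topFaces (K : FinSimplicialComplex V) : Finset (Finset V) :=
  K.faceFinset.filter fun s => s.card = K.dim + 1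

open Classical in
/-- The free codimension-one faces: the free faces of dimension `K.dim - 1`. -/
noncomputable def freeCodimOneFaces (K : FinSimplicialComplex V) : Finset (Finset V) :=
  K.faceFinset.filter fun s => s.card = K.dim ∧ K.IsFree s

theorem topFaces_nonempty {K : FinSimplicialComplex V} (hK : K.faces ≠ ∅) :
    K.topFaces.Nonempty := by
  have hne : K.faceFinset.Nonempty := by
    simpa [faceFinset, Set.nonempty_iff_ne_empty] using hK
  obtain ⟨s, hs, h⟩ := Finset.exists_mem_eq_sup K.faceFinset hne fun s => s.card - 1
  have hs' : s ∈ K.faces := by simpa [faceFinset] using hs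
  have := (K.isRelLowerSet_faces hs').1.card_pos
  refine ⟨s, Finset.mem_filter.2 ⟨hs, ?_⟩⟩
  have h' : K.dim = s.card - 1 := h
  omega

theorem card_deleteFace_lt {K : FinSimplicialComplex V} {s : Finset V} (hs : s ∈ K.faceFinset) :
    (K.deleteFace s).faceFinset.card < K.faceFinset.card := by
  refine Finset.card_lt_card (Finset.ssubset_iff_of_subset ?_ |>.2 ⟨s, hs, ?_⟩)
  · intro u hu
    simp only [faceFinset, Set.Finite.mem_toFinset, deleteFace, Set.mem_ofPred_eq] at hu ⊢
    exact hu.1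
  · simp [faceFinset, deleteFace]

open Classical in
/-- The law of the numbers `(c₀, c₁, c₂, …)` of critical faces found by the algorithm
Random Discrete Morse. Stop if the complex is empty. Otherwise, if there are free codimension-one
faces, pick one uniformly at random, delete it together with the unique face that contains it, and
go on. Otherwise, pick one of the top-dimensional faces uniformly at random, delete it, increment
the entry that belongs to its dimension, and go on. -/
noncomputable def criticalLaw (K : FinSimplicialComplex V) : PMF (ℕ → ℕ) :=
  if h0 : K.faces = ∅ then PMF.pure 0
  else if h1 : K.freeCodimOneFaces.Nonempty then
    haveI : Nonempty {s // s ∈ K.freeCodimOneFaces} := h1.to_subtype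
    (PMF.uniformOfFintype {s // s ∈ K.freeCodimOneFaces}).bind fun s =>
      criticalLaw (K.deleteFace s.1)
  else
    haveI : Nonempty {s // s ∈ K.topFaces} := (topFaces_nonempty h0).to_subtype
    (PMF.uniformOfFintype {s // s ∈ K.topFaces}).bind fun s =>
      (criticalLaw (K.deleteFace s.1)).map fun c => c + Pi.single K.dim 1
termination_by K.faceFinset.card
decreasing_by
  · exact card_deleteFace_lt (Finset.mem_filter.1 s.2).1
  · exact card_deleteFace_lt (Finset.mem_filter.1 s.2).1

/-- The discrete Morse spectrum: the probability distribution of the discrete Morse vector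
`(c₀, …, c_d)`, where `d = K.dim`, that Random Discrete Morse returns for `K`. -/
noncomputable def morseSpectrum (K : FinSimplicialComplex V) : PMF (Fin (K.dim + 1) → ℕ) :=
  K.criticalLaw.map fun c i => c i

/-- The normalization `(1, c₁ - c₀ + 1, c₂, …, c_d)` of `(c₀, …, c_d)`. -/
def normalizeVector {d : ℕ} (c : Fin (d + 1) → ℕ) : Fin (d + 1) → ℤ := fun i =>
  if i.val = 0 then 1 else if i.val = 1 then (c i : ℤ) - c 0 + 1 else c i

/-- The normalized discrete Morse spectrum (of a connected complex). -/
noncomputable def normalizedMorseSpectrum (K : FinSimplicialComplex V) :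
    PMF (Fin (K.dim + 1) → ℤ) :=
  K.morseSpectrum.map normalizeVector

/-- `c_σ`: the average number of critical cells for the vectors in the discrete Morse spectrum. -/
noncomputable def averageCritical (K : FinSimplicialComplex V) : ℝ :=
  ∑' c, (K.morseSpectrum c).toReal * ((∑ i, c i : ℕ) : ℝ)

/-- `c^N_σ`: the average number of critical cells for the vectors in the normalized discrete Morse
spectrum. -/
noncomputable def averageCriticalNormalized (K : FinSimplicialComplex V) : ℝ :=
  ∑' c, (K.normalizedMorseSpectrum c).toReal * ((∑ i, c i : ℤ) : ℝ)

end RandomDiscreteMorse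

end FinSimplicialComplex

/-! Everything rests on one combinatorial fact, `exists_degree_eq_one`: on at most seven vertices, a
nonempty uniform family of sets of size at least two that contains no mod 2 cycle has a free face of
codimension one. The top faces of an acyclic complex contain no cycle, since nothing of higher
dimension could bound it, and an elementary collapse preserves acyclicity. Hence a free
codimension-one face is available until dimension 0, where acyclicity leaves a single vertex. So all
collapsing sequences can be continued to a point, and the random algorithm meets no critical face
before the last vertex.

For the combinatorial fact, suppose that F consists of (k+2)-subsets of a 7-set and has neither a
cycle nor a free face. Three constraints compete. Linear algebra: the mod 2 boundary is injective on
subfamilies of F, and a cycle of (k+1)-sets is determined by its members outside any cycle-free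
family. Discarding the sets through a vertex v gives |F| ≤ the number of covered (k+1)-sets avoiding
v. Cones: for each vertex v some (k+1)-set of odd degree avoids v and does not extend by v to a
member of F; otherwise coning off the boundary of the members avoiding v gives a cycle. Without free
faces odd degrees are at least 3, so many odd sets are needed. Degree counting: covered sets have
degree at least 2, and odd ones at least 3.

Together these force k = 2. Then a second-moment count over 5-subsets confines |F| to 16, 17 or 18
and fixes the number of covered triples as 2|F| - 4. Improving the linear algebra bound by one at
every vertex and summing over the vertices gives the contradiction. -/

namespace SetFamily
open Finset

/-! ### Mod 2 boundaries and cycle-free families. -/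

variable {α : Type*} [DecidableEq α]

/-- The number of members of `F` that contain `s`. -/
def degree (F : Finset (Finset α)) (s : Finset α) : ℕ := #{t ∈ F | s ⊆ t}

theorem degree_symmDiff (F G : Finset (Finset α)) (s : Finset α) :
    Odd (degree (symmDiff F G) s) ↔ ¬ (Odd (degree F s) ↔ Odd (degree G s)) := by
  have h1 : degree (symmDiff F G) s + 2 * #{t ∈ F ∩ G | s ⊆ t} = degree F s + degree G s := by
    simp only [degree, card_filter]
    rw [← sum_union_inter (s₁ := F) (s₂ := G), symmDiff_eq_sup_sdiff_inf, two_mul, ← add_assoc]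
    congr 1
    exact sum_sdiff (inter_subset_union)
  have h2 : Odd (degree (symmDiff F G) s) ↔ Odd (degree F s + degree G s) := by
    rw [← h1, Nat.odd_add]; simp
  rw [h2, Nat.odd_add, ← Nat.not_odd_iff_even]
  tauto

theorem exists_of_odd_degree {F : Finset (Finset α)} {s : Finset α} (h : Odd (degree F s)) :
    ∃ t ∈ F, s ⊆ t := by
  obtain ⟨t, ht⟩ := card_pos.1 h.pos
  exact ⟨t, (mem_filter.1 ht).1, (mem_filter.1 ht).2⟩

theorem degree_eq_one_of_unique {F : Finset (Finset α)} {s t : Finset α} (ht : t ∈ F)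
    (hst : s ⊆ t) (h : ∀ u ∈ F, s ⊆ u → u = t) : degree F s = 1 := by
  rw [degree, card_eq_one]
  refine ⟨t, ?_⟩
  ext u
  simp only [mem_filter, mem_singleton]
  exact ⟨fun hu => h u hu.1 hu.2, by rintro rfl; exact ⟨ht, hst⟩⟩

/-- No nonempty subfamily of `F` is a mod 2 cycle in the sense that it covers every
set of size `k` an even number of times. -/
def HasNoCycle (k : ℕ) (F : Finset (Finset α)) : Prop :=
  ∀ G ⊆ F, G.Nonempty → ∃ s, #s = k ∧ Odd (degree G s)

/-- In a family of sets through v, removing v from a member leaves a set that lies in that member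
only. -/
theorem hasNoCycle_of_forall_mem {k : ℕ} {D : Finset (Finset α)} {v : α}
    (hD : ∀ s ∈ D, #s = k + 1 ∧ v ∈ s) : HasNoCycle k D := by
  intro C hC ⟨s, hs⟩
  have h1 := hD s (hC hs)
  refine ⟨s.erase v, by rw [card_erase_of_mem h1.2]; omega, ?_⟩
  rw [degree_eq_one_of_unique hs (erase_subset _ _)]
  · exact odd_one
  · intro u hu hsu
    have h2 := hD u (hC hu)
    have : s ⊆ u := by
      rw [← insert_erase h1.2]
      exact insert_subset h2.2 hsu
    exact (eq_of_subset_of_card_le this (by omega)).symm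

/-- A set has exactly two intermediate sets below a superset with two more elements. -/
theorem card_between {r t : Finset α} (h : r ⊆ t) (hc : #t = #r + 2) :
    #{s ∈ t.powersetCard (#r + 1) | r ⊆ s} = 2 := by
  have h2 : #(t \ r) = 2 := by rw [card_sdiff_of_subset h]; omega
  rw [← h2]
  symm
  apply card_bij (fun x _ => insert x r)
  · intro x hx
    rw [mem_sdiff] at hx
    simp only [mem_filter, mem_powersetCard]
    exact ⟨⟨insert_subset hx.1 h, card_insert_of_notMem hx.2⟩, subset_insert _ _⟩
  · intro x hx y hy hxy
    rw [mem_sdiff] at hx hy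
    have : x ∈ insert y r := hxy ▸ mem_insert_self x r
    exact (mem_insert.1 this).resolve_right hx.2
  · intro s hs
    simp only [mem_filter, mem_powersetCard] at hs
    obtain ⟨x, hx, rfl⟩ : ∃ x ∉ r, insert x r = s := by
      have := (covBy_iff_card_sdiff_eq_one.2 ⟨hs.2, by
        rw [card_sdiff_of_subset hs.2]; omega⟩ : r ⋖ s)
      exact covBy_iff_exists_insert.1 this
    exact ⟨x, mem_sdiff.2 ⟨hs.1.1 (mem_insert_self _ _), hx⟩, rfl⟩

section Fintype

variable [Fintype α]

/-- The sets of size `k` that lie in an odd number of members of `F`. -/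
def oddPart (k : ℕ) (F : Finset (Finset α)) : Finset (Finset α) :=
  {s ∈ powersetCard k univ | Odd (degree F s)}

/-- The sets of size `k` that lie in a member of `F`. -/
def shadow (k : ℕ) (F : Finset (Finset α)) : Finset (Finset α) :=
  {s ∈ powersetCard k univ | 0 < degree F s}

theorem mem_oddPart {k : ℕ} {F : Finset (Finset α)} {s : Finset α} :
    s ∈ oddPart k F ↔ #s = k ∧ Odd (degree F s) := by
  simp [oddPart, mem_powersetCard]

theorem mem_shadow {k : ℕ} {F : Finset (Finset α)} {s : Finset α} :
    s ∈ shadow k F ↔ #s = k ∧ 0 < degree F s := by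
  simp [shadow, mem_powersetCard]

theorem mem_shadow_of_subset {k : ℕ} {F : Finset (Finset α)} {s t : Finset α} (hs : #s = k)
    (ht : t ∈ F) (h : s ⊆ t) : s ∈ shadow k F :=
  mem_shadow.2 ⟨hs, card_pos.2 ⟨t, mem_filter.2 ⟨ht, h⟩⟩⟩

/-- This is ∂∂ = 0 mod 2: a set lies below a superset with two more elements through exactly two
intermediate sets. -/
theorem even_degree_oddPart {k : ℕ} {F : Finset (Finset α)} (hF : ∀ t ∈ F, #t = k + 1)
    {r : Finset α} (hr : #r + 1 = k) : Even (degree (oddPart k F) r) := by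
  have h1 : degree (oddPart k F) r = ∑ s ∈ powersetCard k univ with r ⊆ s,
      if Odd (degree F s) then 1 else 0 := by
    rw [degree, oddPart, ← card_filter, filter_filter, filter_filter]
    congr 1; ext s; simp [and_comm]
  have h2 : (degree (oddPart k F) r : ZMod 2) =
      ∑ s ∈ powersetCard k univ with r ⊆ s, (degree F s : ZMod 2) := by
    rw [h1]; push_cast
    refine sum_congr rfl fun s _ => ?_
    split_ifs with h
    · exact ((ZMod.natCast_eq_one_iff_odd).2 h).symm
    · exact ((ZMod.natCast_eq_zero_iff_even).2 (Nat.not_odd_iff_even.1 h)).symm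
  have h3 : ∑ s ∈ powersetCard k univ with r ⊆ s, degree F s =
      ∑ t ∈ F, #{s ∈ powersetCard k univ | r ⊆ s ∧ s ⊆ t} := by
    refine (sum_card_bipartiteAbove_eq_sum_card_bipartiteBelow
      (fun s t : Finset α => s ⊆ t)).trans ?_
    refine sum_congr rfl fun t _ => ?_
    rw [bipartiteBelow, filter_filter]
  rw [← ZMod.natCast_eq_zero_iff_even, h2, ← Nat.cast_sum, h3, ZMod.natCast_eq_zero_iff_even]
  refine even_sum _ fun t ht => ?_
  by_cases hrt : r ⊆ t
  · have := card_between hrt (by rw [hF t ht]; omega)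
    rw [hr] at this
    have h4 : ({s ∈ powersetCard k univ | r ⊆ s ∧ s ⊆ t} : Finset (Finset α)) =
        {s ∈ t.powersetCard k | r ⊆ s} := by
      ext s; simp only [mem_filter, mem_powersetCard, subset_univ, true_and]; tauto
    rw [h4, this]
    exact even_two
  · rw [filter_false_of_mem fun s _ h => hrt (h.1.trans h.2)]
    simp

/-- A family without cycles injects into the part of its shadow outside a family without cycles. -/
theorem card_le_card_shadow_sdiff {k : ℕ} {F D : Finset (Finset α)} (hF : ∀ t ∈ F, #t = k + 2)
    (hc : HasNoCycle (k + 1) F) (hD : HasNoCycle k D) : #F ≤ #(shadow (k + 1) F \ D) := by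
  -- Send a subfamily to its boundary with D discarded. If two subfamilies have the same image, the
  -- boundary of their symmetric difference is a cycle inside D, hence empty; so the symmetric
  -- difference is a cycle in F, hence empty too. Comparing the powers of 2 replaces a comparison of
  -- dimensions.
  have key : #F.powerset ≤ #(shadow (k + 1) F \ D).powerset := by
    refine card_le_card_of_injOn (fun G => oddPart (k + 1) G \ D) ?_ ?_
    · intro G hG
      have hG' : G ⊆ F := by simpa using hG
      have : oddPart (k + 1) G \ D ⊆ shadow (k + 1) F \ D := by
        refine sdiff_subset_sdiff ?_ subset_rfl
        intro s hs
        obtain ⟨hs, ho⟩ := mem_oddPart.1 hs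
        obtain ⟨t, ht, hst⟩ := exists_of_odd_degree ho
        exact mem_shadow_of_subset hs (hG' ht) hst
      exact mem_coe.2 (mem_powerset.2 this)
    · intro G hG G' hG' hGG
      have hG1 : G ⊆ F := by simpa using hG
      have hG2 : G' ⊆ F := by simpa using hG'
      by_contra hne
      have hsub : symmDiff G G' ⊆ F := by
        intro x hx
        rcases mem_symmDiff.1 hx with h | h
        exacts [hG1 h.1, hG2 h.1]
      have hne' : (symmDiff G G').Nonempty := by
        rw [nonempty_iff_ne_empty]
        exact fun h => hne (symmDiff_eq_bot.1 h)
      obtain ⟨s, hs, ho⟩ := hc _ hsub hne'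
      have hsD : oddPart (k + 1) (symmDiff G G') ⊆ D := by
        intro u hu
        by_contra huD
        obtain ⟨hu1, hu2⟩ := mem_oddPart.1 hu
        rw [degree_symmDiff] at hu2
        apply hu2
        have := Finset.ext_iff.1 hGG u
        simpa [mem_oddPart, huD, hu1] using this
      obtain ⟨r, hr, ho'⟩ := hD _ hsD ⟨s, mem_oddPart.2 ⟨hs, ho⟩⟩
      exact Nat.not_even_iff_odd.2 ho'
        (even_degree_oddPart (fun t ht => hF t (hsub ht)) (by omega))
  rw [card_powerset, card_powerset] at key
  exact (Nat.pow_le_pow_iff_right (by norm_num)).1 key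

theorem card_le_card_shadow_avoiding {k : ℕ} {F : Finset (Finset α)} (hF : ∀ t ∈ F, #t = k + 2)
    (hc : HasNoCycle (k + 1) F) (v : α) : #F ≤ #{s ∈ shadow (k + 1) F | v ∉ s} := by
  have := card_le_card_shadow_sdiff hF hc (D := {s ∈ powersetCard (k + 1) univ | v ∈ s})
    (hasNoCycle_of_forall_mem (v := v) fun s hs => by
      simpa [mem_powersetCard] using hs)
  refine this.trans (card_le_card ?_)
  intro s hs
  simp only [mem_sdiff, mem_filter, mem_powersetCard, subset_univ, true_and] at hs ⊢
  have := (mem_shadow.1 hs.1).1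
  exact ⟨hs.1, fun h => hs.2 ⟨this, h⟩⟩

/-- In the star of v, exchange the uncovered set p for the covered set q. Discarding p was useless,
whereas q now is discarded as well, which gains one. -/
theorem card_lt_card_shadow_avoiding {k : ℕ} {F : Finset (Finset α)} (hF : ∀ t ∈ F, #t = k + 2)
    (hc : HasNoCycle (k + 1) F) {v : α} {p q : Finset α} (hp : #p = k + 1)
    (hpF : p ∉ shadow (k + 1) F) (hv : v ∈ p) (hq : q ∈ shadow (k + 1) F) (hpq : p.erase v ⊆ q) :
    #F + 1 ≤ #{s ∈ shadow (k + 1) F | v ∉ s} := by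
  have hqc := (mem_shadow.1 hq).1
  have hvq : v ∉ q := by
    intro h
    have : p ⊆ q := by
      rw [← insert_erase hv]
      exact insert_subset h hpq
    exact hpF (eq_of_subset_of_card_le this (by omega) ▸ hq)
  set S : Finset (Finset α) := {s ∈ powersetCard (k + 1) univ | v ∈ s} with hS
  have hmS : ∀ s, s ∈ S ↔ #s = k + 1 ∧ v ∈ s := fun s => by simp [hS, mem_powersetCard]
  have hD : HasNoCycle k (insert q (S.erase p)) := by
    intro C hC hne
    -- The exchange creates no cycle: the only set through v above `p.erase v` was p, so q alone
    -- covers `p.erase v`.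
    by_cases hqC : q ∈ C
    · refine ⟨p.erase v, by rw [card_erase_of_mem hv]; omega, ?_⟩
      rw [degree_eq_one_of_unique hqC hpq]
      · exact odd_one
      · intro u hu hpu
        rcases mem_insert.1 (hC hu) with h | h
        · exact h
        · have hu' := (hmS u).1 (mem_of_mem_erase h)
          exfalso
          have : p ⊆ u := by
            rw [← insert_erase hv]
            exact insert_subset hu'.2 hpu
          exact ne_of_mem_erase h (eq_of_subset_of_card_le this (by omega)).symm
    · have hCS : C ⊆ S := fun u hu => by
        rcases mem_insert.1 (hC hu) with h | h
        · exact absurd (h ▸ hu) hqC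
        · exact mem_of_mem_erase h
      exact hasNoCycle_of_forall_mem (fun s hs => (hmS s).1 hs) C hCS hne
  have h1 := card_le_card_shadow_sdiff hF hc hD
  have h2 : shadow (k + 1) F \ insert q (S.erase p) ⊆
      ({s ∈ shadow (k + 1) F | v ∉ s} : Finset (Finset α)).erase q := by
    intro s hs
    simp only [mem_sdiff, mem_insert, mem_erase, not_or, mem_filter] at hs ⊢
    refine ⟨hs.2.1, hs.1, fun hvs => hs.2.2 ⟨?_, (hmS s).2 ⟨(mem_shadow.1 hs.1).1, hvs⟩⟩⟩
    rintro rfl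
    exact hpF hs.1
  have h3 := card_le_card h2
  have h4 : q ∈ ({s ∈ shadow (k + 1) F | v ∉ s} : Finset (Finset α)) := mem_filter.2 ⟨hq, hvq⟩
  have := card_erase_add_one h4
  omega

/-- The cone construction: if no set of size `k` avoiding `v` is odd while its extension by `v`
is missing from `F`, then `F` contains the boundary of a cone. -/
theorem exists_odd_of_hasNoCycle {k : ℕ} {F : Finset (Finset α)} (hF : ∀ t ∈ F, #t = k + 1)
    (hc : HasNoCycle k F) {v : α} (hv : ∃ t ∈ F, v ∉ t) :
    ∃ s ∈ oddPart k F, v ∉ s ∧ insert v s ∉ F := by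
  by_contra! hcon
  set G : Finset (Finset α) := {t ∈ F | v ∉ t} with hG
  have hGF : G ⊆ F := filter_subset _ _
  set B : Finset (Finset α) := {s ∈ oddPart k G | v ∉ s} with hB
  have hBv : ∀ s ∈ B, #s = k ∧ v ∉ s := fun s hs => by
    rw [hB, mem_filter, mem_oddPart] at hs
    exact ⟨hs.1.1, hs.2⟩
  have hGv : ∀ t ∈ G, v ∉ t := fun t ht => (mem_filter.1 ht).2
  have hoddG : oddPart k G = B := by
    rw [hB, eq_comm, filter_eq_self]
    intro s hs hvs
    obtain ⟨t, ht, hst⟩ := exists_of_odd_degree (mem_oddPart.1 hs).2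
    exact hGv t ht (hst hvs)
  set C : Finset (Finset α) := B.image (insert v) with hC
  have hCF : C ⊆ F := by
    intro u hu
    obtain ⟨s, hs, rfl⟩ := mem_image.1 hu
    by_contra hns
    have hs' := hBv s hs
    refine hns (hcon s (mem_oddPart.2 ⟨hs'.1, ?_⟩) hs'.2)
    -- As `insert v s` is not in F, every member of F above s avoids v.
    have : degree F s = degree G s := by
      rw [degree, degree, hG, filter_filter]
      congr 1
      refine filter_congr fun t ht => ⟨fun hst => ⟨fun hvt => hns ?_, hst⟩, fun h => h.2⟩
      have : insert v s = t := by
        refine eq_of_subset_of_card_le (insert_subset hvt hst) ?_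
        rw [hF t ht, card_insert_of_notMem hs'.2, hs'.1]
      exact this ▸ ht
    rw [this]
    rw [← hoddG] at hs
    exact (mem_oddPart.1 hs).2
  obtain ⟨t₀, ht₀, hvt₀⟩ := hv
  obtain ⟨r, hr, ho⟩ := hc (G ∪ C) (union_subset hGF hCF)
    ⟨t₀, mem_union_left _ (mem_filter.2 ⟨ht₀, hvt₀⟩)⟩
  have hdisj : Disjoint G C := by
    rw [disjoint_left]
    intro t ht hC'
    obtain ⟨s, hs, rfl⟩ := mem_image.1 hC'
    exact hGv _ ht (mem_insert_self _ _)
  have hdeg : degree (G ∪ C) r = degree G r + degree C r := by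
    rw [degree, filter_union, card_union_of_disjoint (disjoint_filter_filter hdisj)]
    rfl
  have hinj : Set.InjOn (insert v) (B : Set (Finset α)) := by
    intro s hs s' hs' h
    rw [← erase_insert (hBv s hs).2, h, erase_insert (hBv s' hs').2]
  have hdegC : degree C r = degree B (r.erase v) := by
    rw [degree, degree, hC, filter_image, card_image_of_injOn (hinj.mono (by
      intro s hs; exact (mem_filter.1 hs).1))]
    congr 1
    refine filter_congr fun s _ => ?_
    exact subset_insert_iff
  rw [hdeg, hdegC] at ho
  -- The union of G and the cone C is a cycle: below a set through v one sees the boundary of the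
  -- boundary of G, and at a set avoiding v the degrees from G and from C have equal parity.
  by_cases hvr : v ∈ r
  · have h1 : degree G r = 0 := by
      rw [degree, card_eq_zero, filter_eq_empty_iff]
      exact fun t ht h => hGv t ht (h hvr)
    rw [h1, zero_add, ← hoddG] at ho
    refine Nat.not_even_iff_odd.2 ho (even_degree_oddPart (fun t ht => hF t (hGF ht)) ?_)
    rw [card_erase_add_one hvr, hr]
  · rw [erase_eq_of_notMem hvr] at ho
    have h2 : degree B r = if r ∈ B then 1 else 0 := by
      rw [degree]
      split_ifs with h
      · exact degree_eq_one_of_unique h subset_rfl fun u hu hru =>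
          (eq_of_subset_of_card_le hru (by rw [(hBv u hu).1, hr])).symm
      · rw [card_eq_zero, filter_eq_empty_iff]
        intro u hu hru
        exact h (eq_of_subset_of_card_le hru (by rw [(hBv u hu).1, hr]) ▸ hu)
    have h3 : r ∈ B ↔ Odd (degree G r) := by
      rw [← hoddG, mem_oddPart]
      exact and_iff_right hr
    by_cases hodd : Odd (degree G r)
    · rw [h2, if_pos (h3.2 hodd)] at ho
      exact (Nat.not_even_iff_odd.2 ho) hodd.add_one
    · rw [h2, if_neg (mt h3.1 hodd)] at ho
      exact hodd ho

end Fintype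

end SetFamily

/-! ### Double counting of incidences. -/

namespace SetFamily
open Finset

variable {α : Type*} [DecidableEq α] [Fintype α]

theorem card_supersets (m : ℕ) (t : Finset α) (hm : #t ≤ m) :
    #{R ∈ powersetCard m (univ : Finset α) | t ⊆ R} = (Fintype.card α - #t).choose (m - #t) := by
  rw [← card_compl, ← card_powersetCard]
  apply card_bij' (fun R _ => R \ t) (fun S _ => S ∪ t)
  · intro R hR
    simp only [mem_filter, mem_powersetCard, subset_univ, true_and] at hR ⊢
    refine ⟨fun x hx => mem_compl.2 (mem_sdiff.1 hx).2, ?_⟩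
    rw [card_sdiff_of_subset hR.2, hR.1]
  · intro S hS
    simp only [mem_filter, mem_powersetCard, subset_univ, true_and] at hS ⊢
    refine ⟨?_, subset_union_right⟩
    rw [card_union_of_disjoint (disjoint_left.2 fun x hx => mem_compl.1 (hS.1 hx)), hS.2]
    omega
  · intro R hR
    simp only [mem_filter] at hR
    exact sdiff_union_of_subset hR.2
  · intro S hS
    simp only [mem_powersetCard] at hS
    exact union_sdiff_cancel_right (disjoint_left.2 fun x hx => mem_compl.1 (hS.1 hx))

theorem sum_degree {k : ℕ} {F : Finset (Finset α)} (hF : ∀ t ∈ F, #t = k + 1) :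
    ∑ s ∈ powersetCard k univ, degree F s = (k + 1) * #F := by
  refine (sum_card_bipartiteAbove_eq_sum_card_bipartiteBelow
    (fun s t : Finset α => s ⊆ t)).trans ?_
  rw [mul_comm, ← smul_eq_mul, ← sum_const]
  refine sum_congr rfl fun t ht => ?_
  have : bipartiteBelow (fun s t : Finset α => s ⊆ t) (powersetCard k univ) t =
      powersetCard k t := by
    ext s
    simp [bipartiteBelow, mem_powersetCard, and_comm]
  rw [this, card_powersetCard, hF t ht, Nat.choose_succ_self_right]

theorem sum_degree_sq {F : Finset (Finset α)} (k : ℕ) :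
    ∑ s ∈ powersetCard k univ, degree F s ^ 2 =
      ∑ p ∈ F ×ˢ F, #(powersetCard k (p.1 ∩ p.2)) := by
  have h : ∀ s, degree F s ^ 2 = #(bipartiteAbove
      (fun (s : Finset α) (p : Finset α × Finset α) => s ⊆ p.1 ∩ p.2) (F ×ˢ F) s) := fun s => by
    rw [sq, degree, ← card_product, ← filter_product]
    congr 1
    exact filter_congr fun p _ => subset_inter_iff.symm
  rw [sum_congr rfl fun s _ => h s, sum_card_bipartiteAbove_eq_sum_card_bipartiteBelow]
  refine sum_congr rfl fun p _ => ?_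
  congr 1
  ext s
  simp [bipartiteBelow, mem_powersetCard, and_comm]

theorem card_extensions {k : ℕ} {F : Finset (Finset α)} (hF : ∀ t ∈ F, #t = k + 1)
    {s : Finset α} (hs : #s = k) :
    #{v | v ∉ s ∧ insert v s ∉ F} + degree F s = Fintype.card α - k := by
  have h1 : degree F s = #{v | v ∉ s ∧ insert v s ∈ F} := by
    symm
    apply card_bij (fun v _ => insert v s)
    · intro v hv
      simp only [mem_filter, mem_univ, true_and] at hv ⊢
      exact ⟨hv.2, subset_insert _ _⟩
    · intro v hv w hw h
      simp only [mem_filter, mem_univ, true_and] at hv hw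
      exact (mem_insert.1 (h ▸ mem_insert_self v s : v ∈ insert w s)).resolve_right hv.1
    · intro t ht
      simp only [mem_filter] at ht
      have := (covBy_iff_card_sdiff_eq_one.2 ⟨ht.2, by
        rw [card_sdiff_of_subset ht.2, hF t ht.1]; omega⟩ : s ⋖ t)
      obtain ⟨x, hx, rfl⟩ := covBy_iff_exists_insert.1 this
      exact ⟨x, by simpa using ⟨hx, ht.1⟩, rfl⟩
  rw [h1, ← card_union_of_disjoint, ← hs, ← card_compl]
  · congr 1
    ext v
    simp only [mem_union, mem_filter, mem_univ, true_and, mem_compl]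
    tauto
  · rw [disjoint_filter]
    tauto

theorem sum_card_avoiding {k : ℕ} {A : Finset (Finset α)} (hA : ∀ s ∈ A, #s = k) :
    ∑ v : α, #{s ∈ A | v ∉ s} = #A * (Fintype.card α - k) := by
  refine (sum_card_bipartiteAbove_eq_sum_card_bipartiteBelow
    (fun (v : α) (s : Finset α) => v ∉ s)).trans ?_
  rw [← smul_eq_mul, ← sum_const]
  refine sum_congr rfl fun s hs => ?_
  rw [← hA s hs, ← card_compl]
  congr 1
  ext v
  simp [bipartiteBelow]

theorem card_mul_card_le {k : ℕ} {F : Finset (Finset α)} (hF : ∀ t ∈ F, #t = k + 2)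
    (hc : HasNoCycle (k + 1) F) :
    Fintype.card α * #F ≤ #(shadow (k + 1) F) * (Fintype.card α - (k + 1)) := by
  rw [← sum_card_avoiding fun s hs => (mem_shadow.1 hs).1, ← card_univ, ← smul_eq_mul, ← sum_const]
  exact sum_le_sum fun v _ => card_le_card_shadow_avoiding hF hc v

theorem sum_degree_shadow {k : ℕ} {F : Finset (Finset α)} (hF : ∀ t ∈ F, #t = k + 1) :
    ∑ s ∈ shadow k F, degree F s = (k + 1) * #F := by
  rw [← sum_degree hF, shadow, sum_filter]
  exact sum_congr rfl fun s _ => by split_ifs <;> omega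

variable {k : ℕ} {F : Finset (Finset α)}

/-! ### Cycle-free families without free faces: reduction to `k = 2`. -/

/-- The hypotheses of a minimal counterexample: a nonempty family of sets of size `k + 2` without
cycles and without free faces. -/
structure IsBad (k : ℕ) (F : Finset (Finset α)) : Prop where
  card_eq : ∀ t ∈ F, #t = k + 2
  hasNoCycle : HasNoCycle (k + 1) F
  degree_ne_one : ∀ s, #s = k + 1 → degree F s ≠ 1
  nonempty : F.Nonempty

namespace IsBad

omit [Fintype α] in
theorem exists_avoiding (h : IsBad k F) (v : α) : ∃ t ∈ F, v ∉ t := by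
  by_contra! hcon
  obtain ⟨t, ht⟩ := h.nonempty
  have hvt := hcon t ht
  refine h.degree_ne_one (t.erase v) (by rw [card_erase_of_mem hvt, h.card_eq t ht]; omega)
    (degree_eq_one_of_unique ht (erase_subset _ _) fun u hu hsu => ?_)
  have : t ⊆ u := by
    rw [← insert_erase hvt]
    exact insert_subset (hcon u hu) hsu
  exact (eq_of_subset_of_card_le this (by rw [h.card_eq t ht, h.card_eq u hu])).symm

theorem exists_odd (h : IsBad k F) (v : α) :
    ∃ s ∈ oddPart (k + 1) F, v ∉ s ∧ insert v s ∉ F :=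
  exists_odd_of_hasNoCycle h.card_eq h.hasNoCycle (h.exists_avoiding v)

theorem three_le_degree (h : IsBad k F) {s : Finset α} (hs : s ∈ oddPart (k + 1) F) :
    3 ≤ degree F s := by
  have h1 := mem_oddPart.1 hs
  have h2 := h.degree_ne_one s h1.1
  obtain ⟨m, hm⟩ := h1.2
  omega

theorem two_le_degree (h : IsBad k F) {s : Finset α} (hs : s ∈ shadow (k + 1) F) :
    2 ≤ degree F s := by
  have h1 := mem_shadow.1 hs
  have h2 := h.degree_ne_one s h1.1
  omega

theorem two_mul_card_shadow_add_le (h : IsBad k F) :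
    2 * #(shadow (k + 1) F) + #(oddPart (k + 1) F) ≤ (k + 2) * #F := by
  rw [← sum_degree_shadow h.card_eq]
  have h1 : oddPart (k + 1) F = {s ∈ shadow (k + 1) F | Odd (degree F s)} := by
    ext s
    simp only [mem_oddPart, mem_filter, mem_shadow]
    exact ⟨fun hs => ⟨⟨hs.1, hs.2.pos⟩, hs.2⟩, fun hs => ⟨hs.1.1, hs.2⟩⟩
  rw [h1, card_filter, mul_comm, ← smul_eq_mul, ← sum_const, ← sum_add_distrib]
  refine sum_le_sum fun s hs => ?_
  split_ifs with ho
  · exact h.three_le_degree (mem_oddPart.2 ⟨(mem_shadow.1 hs).1, ho⟩)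
  · exact h.two_le_degree hs

theorem card_shadow_pos (h : IsBad k F) : 0 < #(shadow (k + 1) F) := by
  obtain ⟨t, ht⟩ := h.nonempty
  obtain ⟨s, hst, hs⟩ := exists_subset_card_eq (s := t) (n := k + 1) (by rw [h.card_eq t ht]; omega)
  exact card_pos.2 ⟨s, mem_shadow_of_subset hs ht hst⟩

/-- Every vertex is missed by an odd set of which it is not an extension, and an odd set serves
at most `card α - k - 4` vertices. -/
theorem card_le_card_oddPart_mul (h : IsBad k F) :
    Fintype.card α ≤ #(oddPart (k + 1) F) * (Fintype.card α - (k + 1) - 3) := by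
  calc Fintype.card α = ∑ v : α, 1 := by simp
    _ ≤ ∑ v : α, #{s ∈ oddPart (k + 1) F | v ∉ s ∧ insert v s ∉ F} := by
      refine sum_le_sum fun v _ => card_pos.2 ?_
      obtain ⟨s, hs, hv⟩ := h.exists_odd v
      exact ⟨s, mem_filter.2 ⟨hs, hv⟩⟩
    _ = ∑ s ∈ oddPart (k + 1) F, #{v | v ∉ s ∧ insert v s ∉ F} :=
      sum_card_bipartiteAbove_eq_sum_card_bipartiteBelow
        (fun (v : α) (s : Finset α) => v ∉ s ∧ insert v s ∉ F)
    _ ≤ _ := by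
      rw [← smul_eq_mul, ← sum_const]
      refine sum_le_sum fun s hs => ?_
      have h1 := card_extensions h.card_eq (mem_oddPart.1 hs).1
      have h2 := h.three_le_degree hs
      omega

theorem eq_two (hα : Fintype.card α = 7) (h : IsBad k F) : k = 2 := by
  have h1 := h.card_le_card_oddPart_mul
  have h2 := h.two_mul_card_shadow_add_le
  have h3 := card_mul_card_le h.card_eq h.hasNoCycle
  have h4 := h.card_shadow_pos
  rw [hα] at h1 h3
  have hk : k < 3 := by
    by_contra! hk
    -- The truncated subtraction is harmless: an odd set of degree at least 3 would need three
    -- further vertices, and none are left over.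
    rw [show 7 - (k + 1) - 3 = 0 by omega] at h1
    omega
  interval_cases k
  -- For k = 0, with S the number of covered sets, 2S < 2|F| contradicts 7|F| ≤ 6S.
  · omega
  -- At least 4 odd sets exist, so 2S + 4 ≤ 3|F| and 7|F| ≤ 5S, which force S ≥ 28, more than the 21
  -- pairs.
  · have h5 : #(shadow (1 + 1) F) ≤ 21 := by
      refine (card_le_card (filter_subset _ _)).trans ?_
      rw [card_powersetCard, card_univ, hα]
      decide
    omega
  · rfl

end IsBad

/-! ### Second moments for 4-subsets of a 7-set. -/

/-- The identity between pair counts in sets of size `5` and in sets of size `3`. -/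
theorem sum_card_subsets_sq (hα : Fintype.card α = 7) (hF : ∀ t ∈ F, #t = 4) :
    ∑ R ∈ powersetCard 5 univ, #{t ∈ F | t ⊆ R} ^ 2 + #F =
      ∑ s ∈ powersetCard 3 univ, degree F s ^ 2 := by
  have h : ∀ R, #{t ∈ F | t ⊆ R} ^ 2 = #(bipartiteAbove
      (fun (R : Finset α) (p : Finset α × Finset α) => p.1 ∪ p.2 ⊆ R) (F ×ˢ F) R) := fun R => by
    rw [sq, ← card_product, ← filter_product]
    congr 1
    exact filter_congr fun p _ => union_subset_iff.symm
  rw [sum_congr rfl fun R _ => h R, sum_card_bipartiteAbove_eq_sum_card_bipartiteBelow,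
    sum_degree_sq]
  have hdiag : #F = ∑ p ∈ F ×ˢ F, if p.1 = p.2 then 1 else 0 := by
    rw [sum_product]
    simp
  rw [hdiag, ← sum_add_distrib]
  refine sum_congr rfl fun p hp => ?_
  obtain ⟨hp1, hp2⟩ := mem_product.1 hp
  have h1 := hF _ hp1
  have h2 := hF _ hp2
  have h3 := card_union_add_card_inter p.1 p.2
  have h4 : p.1 = p.2 ↔ #(p.1 ∩ p.2) = 4 := by
    constructor
    · intro e
      rw [e, inter_self, h2]
    · intro e
      rw [← eq_of_subset_of_card_le (inter_subset_left (s₁ := p.1) (s₂ := p.2)) (by omega)]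
      exact eq_of_subset_of_card_le inter_subset_right (by omega)
  have h5 : #(p.1 ∩ p.2) ≤ 4 := (card_le_card inter_subset_left).trans h1.le
  have h6 : #(bipartiteBelow (fun (R : Finset α) (p : Finset α × Finset α) => p.1 ∪ p.2 ⊆ R)
      (powersetCard 5 univ) p) = if #(p.1 ∪ p.2) ≤ 5 then
        (7 - #(p.1 ∪ p.2)).choose (5 - #(p.1 ∪ p.2)) else 0 := by
    split_ifs with hle
    · rw [← hα]
      exact card_supersets 5 _ hle
    · rw [card_eq_zero, bipartiteBelow, filter_eq_empty_iff]
      intro R hR hsub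
      have := card_le_card hsub
      rw [(mem_powersetCard.1 hR).2] at this
      exact hle this
  rw [h6, card_powersetCard]
  simp only [h4]
  have h7 : #(p.1 ∪ p.2) = 8 - #(p.1 ∩ p.2) := by omega
  rw [h7]
  -- Both sides are now functions of the intersection size i. They vanish for i ≤ 2, equal 1 for i =
  -- 3, and read 3 + 1 = 4 on the diagonal i = 4.
  generalize #(p.1 ∩ p.2) = i at h5
  interval_cases i <;> decide

theorem sum_card_subsets (hα : Fintype.card α = 7) (hF : ∀ t ∈ F, #t = 4) :
    ∑ R ∈ powersetCard 5 univ, #{t ∈ F | t ⊆ R} = 3 * #F := by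
  refine (sum_card_bipartiteAbove_eq_sum_card_bipartiteBelow
    (fun R t : Finset α => t ⊆ R)).trans ?_
  rw [mul_comm, ← smul_eq_mul, ← sum_const]
  refine sum_congr rfl fun t ht => ?_
  refine (card_supersets 5 t (by rw [hF t ht]; omega)).trans ?_
  rw [hα, hF t ht]
  rfl

/-- For an integer e, (e - 2)(e - 3) ≥ 0, that is 5e ≤ e² + 6. Summing over the 21 five-sets, with e
the number of members inside, gives 15|F| on the left and 126 = 6 · 21 on the right. -/
theorem sixteen_mul_card_le (hα : Fintype.card α = 7) (hF : ∀ t ∈ F, #t = 4) :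
    16 * #F ≤ ∑ s ∈ powersetCard 3 univ, degree F s ^ 2 + 126 := by
  rw [← sum_card_subsets_sq hα hF]
  have h1 : ∑ R ∈ powersetCard 5 (univ : Finset α), 5 * #{t ∈ F | t ⊆ R} ≤
      ∑ R ∈ powersetCard 5 univ, (#{t ∈ F | t ⊆ R} ^ 2 + 6) := by
    refine sum_le_sum fun R _ => ?_
    generalize #{t ∈ F | t ⊆ R} = e
    rcases le_or_gt e 2 with he | he
    · interval_cases e <;> decide
    · obtain ⟨j, rfl⟩ := Nat.exists_eq_add_of_lt he
      nlinarith
  rw [← mul_sum, sum_card_subsets hα hF, sum_add_distrib, sum_const, card_powersetCard,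
    card_univ, hα] at h1
  have h2 : Nat.choose 7 5 = 21 := by decide
  rw [h2, smul_eq_mul] at h1
  omega

end SetFamily

/-! ### The contradiction for `k = 2`. -/

namespace SetFamily
open Finset

section Final
variable {α : Type*} [DecidableEq α] [Fintype α] {k : ℕ} {F : Finset (Finset α)}

/-- The sets of size `k` covered by no member of `F`. -/
def uncovered (k : ℕ) (F : Finset (Finset α)) : Finset (Finset α) :=
  powersetCard k univ \ shadow k F

theorem mem_uncovered {s : Finset α} : s ∈ uncovered k F ↔ #s = k ∧ s ∉ shadow k F := by
  simp [uncovered, mem_powersetCard]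

theorem card_uncovered_add (hα : Fintype.card α = 7) :
    #(uncovered 3 F) + #(shadow 3 F) = 35 := by
  have := card_sdiff_add_card_eq_card (s := shadow 3 F) (t := powersetCard 3 univ)
    (filter_subset _ _)
  rw [uncovered, this, card_powersetCard, card_univ, hα]
  rfl

theorem card_avoiding_add (hα : Fintype.card α = 7) (v : α) :
    #{s ∈ uncovered 3 F | v ∉ s} + #{s ∈ shadow 3 F | v ∉ s} = 20 := by
  have h1 : powersetCard 3 (univ.erase v) =
      {s ∈ uncovered 3 F | v ∉ s} ∪ {s ∈ shadow 3 F | v ∉ s} := by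
    ext s
    have h2 : s ⊆ univ.erase v ↔ v ∉ s := by
      rw [subset_erase]
      simp
    have h3 : s ∈ shadow 3 F → #s = 3 := fun h => (mem_shadow.1 h).1
    simp only [mem_powersetCard, mem_union, mem_filter, mem_uncovered, h2]
    tauto
  have h4 := congrArg card h1
  rw [card_powersetCard, card_erase_of_mem (mem_univ v), card_univ, hα,
    card_union_of_disjoint] at h4
  · rw [← h4]
    rfl
  · refine disjoint_filter_filter ?_
    exact disjoint_sdiff_self_left

namespace IsBad

theorem degree_le_four (hα : Fintype.card α = 7) (h : IsBad 2 F) {s : Finset α} (hs : #s = 3) :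
    degree F s ≤ 4 := by
  have := card_extensions h.card_eq hs
  omega

theorem numerical_bounds (hα : Fintype.card α = 7) (h : IsBad 2 F) :
    #(shadow 3 F) + 4 = 2 * #F ∧ 16 ≤ #F ∧ #F ≤ 18 := by
  set t : ℕ → ℕ := fun i => #{s ∈ powersetCard 3 univ | degree F s = i} with ht
  have hd : ∀ s ∈ powersetCard 3 (univ : Finset α), degree F s = 0 ∨ degree F s = 2 ∨
      degree F s = 3 ∨ degree F s = 4 := fun s hs => by
    have hs3 := (mem_powersetCard.1 hs).2
    have h1 := h.degree_le_four hα hs3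
    have h2 := h.degree_ne_one s hs3
    omega
  have hsum : ∀ g : ℕ → ℕ, g 0 = 0 → ∑ s ∈ powersetCard 3 univ, g (degree F s) =
      g 2 * t 2 + g 3 * t 3 + g 4 * t 4 := fun g hg => by
    simp only [ht, card_filter, mul_sum, ← sum_add_distrib]
    refine sum_congr rfl fun s hs => ?_
    rcases hd s hs with h | h | h | h <;> simp [h, hg]
  have h1 := sum_degree h.card_eq
  rw [hsum (fun i => i) rfl] at h1
  have h2 := sixteen_mul_card_le hα h.card_eq
  rw [hsum (fun i => i ^ 2) rfl] at h2
  have h3 : #(shadow 3 F) = t 2 + t 3 + t 4 := by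
    rw [shadow, card_filter, hsum (fun i => if 0 < i then 1 else 0) rfl]
    simp
  have h4 : #(oddPart 3 F) = t 3 := by
    rw [oddPart, card_filter, hsum (fun i => if Odd i then 1 else 0) rfl]
    have e2 : ¬ Odd 2 := by decide
    have e3 : Odd 3 := by decide
    have e4 : ¬ Odd 4 := by decide
    simp [e2, e3, e4]
  have h5 := h.card_le_card_oddPart_mul
  have h6 := card_mul_card_le h.card_eq h.hasNoCycle
  simp only [hα] at h5 h6
  norm_num at h1 h2 h5 h6
  -- Write S for the number of covered triples, tᵢ for the number of triples of degree i, and δ =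
  -- 2|F| - S. Then 2δ = t₃ + 2t₄, so t₃ is even; as t₃ ≥ 7, in fact t₃ ≥ 8 and δ ≥ 4. The bound
  -- 7|F| ≤ 4S gives |F| ≥ 4δ, and the second moment gives 4S ≤ 118 + 4δ. Hence δ = 4 and 16 ≤ |F| ≤
  -- 18.
  omega

/-- If no exchange can gain one, then for each uncovered triple p through v all five triples above
`p.erase v` are uncovered. There are 39 - 2|F| uncovered triples, and 19 - |F| ≥ 1 of them contain
v. One such star of five forces |F| ≤ 17, so a second uncovered triple through v exists. Two stars
share at most one triple and so contain at least 9, but at most 7 triples are uncovered. -/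
theorem card_add_one_le (hα : Fintype.card α = 7) (h : IsBad 2 F) (v : α) :
    #F + 1 ≤ #{s ∈ shadow 3 F | v ∉ s} := by
  by_contra hcon
  have hup : ∀ p, p ∈ uncovered 3 F → v ∈ p →
      {q ∈ powersetCard 3 (univ : Finset α) | p.erase v ⊆ q} ⊆ uncovered 3 F := by
    intro p hp hv q hq
    rw [mem_uncovered] at hp ⊢
    simp only [mem_filter, mem_powersetCard, subset_univ, true_and] at hq
    exact ⟨hq.1, fun hqs => hcon
      (card_lt_card_shadow_avoiding h.card_eq h.hasNoCycle hp.1 hp.2 hv hqs hq.2)⟩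
  have hstar : ∀ p, p ∈ uncovered 3 F → v ∈ p →
      #{q ∈ powersetCard 3 (univ : Finset α) | p.erase v ⊆ q} = 5 := by
    intro p hp hv
    have h2 : #(p.erase v) = 2 := by rw [card_erase_of_mem hv, (mem_uncovered.1 hp).1]
    rw [card_supersets 3 _ (by omega), h2, hα]
    rfl
  have hn := h.numerical_bounds hα
  have hU := card_uncovered_add (F := F) hα
  have hv1 := card_avoiding_add (F := F) hα v
  have hv2 : #F ≤ #{s ∈ shadow 3 F | v ∉ s} := card_le_card_shadow_avoiding h.card_eq h.hasNoCycle v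
  have hv3 := card_filter_add_card_filter_not (s := uncovered 3 F) (fun s => v ∈ s)
  obtain ⟨p, hp⟩ : ({s ∈ uncovered 3 F | v ∈ s}).Nonempty := card_pos.1 (by omega)
  rw [mem_filter] at hp
  have h5 := card_le_card (hup p hp.1 hp.2)
  rw [hstar p hp.1 hp.2] at h5
  obtain ⟨p', hp', q', hq', hne⟩ : ∃ a ∈ ({s ∈ uncovered 3 F | v ∈ s} : Finset (Finset α)),
      ∃ b ∈ ({s ∈ uncovered 3 F | v ∈ s} : Finset (Finset α)), a ≠ b :=
    one_lt_card.1 (by omega)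
  rw [mem_filter] at hp' hq'
  have h6 := card_le_card (union_subset (hup p' hp'.1 hp'.2) (hup q' hq'.1 hq'.2))
  have h7 := card_union_add_card_inter {q ∈ powersetCard 3 (univ : Finset α) | p'.erase v ⊆ q}
    {q ∈ powersetCard 3 (univ : Finset α) | q'.erase v ⊆ q}
  rw [hstar p' hp'.1 hp'.2, hstar q' hq'.1 hq'.2] at h7
  have h8 : #({q ∈ powersetCard 3 (univ : Finset α) | p'.erase v ⊆ q} ∩
      {q ∈ powersetCard 3 (univ : Finset α) | q'.erase v ⊆ q}) ≤ 1 := by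
    have hcp : #(p'.erase v) = 2 := by rw [card_erase_of_mem hp'.2, (mem_uncovered.1 hp'.1).1]
    have hcq : #(q'.erase v) = 2 := by rw [card_erase_of_mem hq'.2, (mem_uncovered.1 hq'.1).1]
    have hc : 3 ≤ #(p'.erase v ∪ q'.erase v) := by
      by_contra! hlt
      have e1 := eq_of_subset_of_card_le (subset_union_left (s₁ := p'.erase v) (s₂ := q'.erase v))
        (by omega)
      have e2 := eq_of_subset_of_card_le (subset_union_right (s₁ := p'.erase v) (s₂ := q'.erase v))
        (by omega)
      exact hne (by rw [← insert_erase hp'.2, ← insert_erase hq'.2, e1.trans e2.symm])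
    have hq : ∀ q ∈ ({q ∈ powersetCard 3 (univ : Finset α) | p'.erase v ⊆ q} ∩
      {q ∈ powersetCard 3 (univ : Finset α) | q'.erase v ⊆ q}), p'.erase v ∪ q'.erase v = q := by
      intro q hq
      simp only [mem_inter, mem_filter, mem_powersetCard] at hq
      exact eq_of_subset_of_card_le (union_subset hq.1.2 hq.2.2) (by omega)
    exact card_le_one.2 fun a ha b hb => (hq a ha).symm.trans (hq b hb)
  omega

theorem false (hα : Fintype.card α = 7) (h : IsBad k F) : False := by
  obtain rfl := h.eq_two hα
  have h1 := sum_card_avoiding (A := shadow 3 F) fun s hs => (mem_shadow.1 hs).1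
  have h2 : ∑ v : α, (#F + 1) ≤ ∑ v : α, #{s ∈ shadow 3 F | v ∉ s} :=
    sum_le_sum fun v _ => h.card_add_one_le hα v
  rw [h1, sum_const, card_univ, hα, smul_eq_mul] at h2
  have := h.numerical_bounds hα
  -- Summing over the vertices gives 7(|F| + 1) ≤ 4(2|F| - 4), so |F| ≥ 23, against |F| ≤ 18.
  omega

end IsBad

end Final

/-! ### Transfer to an arbitrary vertex type. -/

section Transfer

variable {α : Type*} [DecidableEq α]

/-- On at most seven vertices, a nonempty family of sets of size `k + 2` which contains no mod 2
cycle has a free face of size `k + 1`. -/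
theorem exists_degree_eq_one {S : Finset α} (hS : #S ≤ 7) {k : ℕ} {F : Finset (Finset α)}
    (hF : ∀ t ∈ F, #t = k + 2 ∧ t ⊆ S) (hc : HasNoCycle (k + 1) F) (hne : F.Nonempty) :
    ∃ s, #s = k + 1 ∧ degree F s = 1 := by
  -- The counts need exactly seven points; points not used by the family do no harm.
  obtain ⟨g, hg⟩ : ∃ g : α → Fin 7, Set.InjOn g S := by
    obtain ⟨e⟩ : Nonempty (S ↪ Fin 7) := by
      refine Function.Embedding.nonempty_of_card_le ?_
      simpa using hS
    refine ⟨fun a => if h : a ∈ S then e ⟨a, h⟩ else 0, fun a ha b hb hab => ?_⟩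
    have ha' : a ∈ S := ha
    have hb' : b ∈ S := hb
    simp only [ha', hb', dif_pos] at hab
    simpa using e.injective hab
  have himg : ∀ {s t : Finset α}, s ⊆ S → t ⊆ S → (s.image g ⊆ t.image g ↔ s ⊆ t) := by
    intro s t hs ht
    refine ⟨fun h a ha => ?_, image_subset_image⟩
    obtain ⟨b, hb, hab⟩ := mem_image.1 (h (mem_image_of_mem g ha))
    rwa [hg (ht hb) (hs ha) hab] at hb
  have hinj : ∀ {s t : Finset α}, s ⊆ S → t ⊆ S → s.image g = t.image g → s = t :=
    fun hs ht h => subset_antisymm ((himg hs ht).1 h.subset) ((himg ht hs).1 h.superset)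
  have hcard : ∀ {s : Finset α}, s ⊆ S → #(s.image g) = #s := fun hs =>
    card_image_of_injOn (hg.mono (by exact_mod_cast hs))
  have hdeg : ∀ {G : Finset (Finset α)} {s : Finset α}, (∀ t ∈ G, t ⊆ S) → s ⊆ S →
      degree (G.image (image g)) (s.image g) = degree G s := by
    intro G s hG hs
    rw [degree, degree, filter_image, card_image_of_injOn]
    · congr 1
      exact filter_congr fun t ht => himg hs (hG t ht)
    · intro t ht t' ht' h
      exact hinj (hG t (mem_filter.1 ht).1) (hG t' (mem_filter.1 ht').1) h
  by_contra! hcon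
  refine IsBad.false (k := k) (F := F.image (image g)) (by simp) ⟨?_, ?_, ?_, hne.image _⟩
  · intro t ht
    obtain ⟨u, hu, rfl⟩ := mem_image.1 ht
    rw [hcard (hF u hu).2, (hF u hu).1]
  · intro G hG hGne
    obtain ⟨G', hG', rfl⟩ := subset_image_iff.1 hG
    have hG'S : ∀ t ∈ G', t ⊆ S := fun t ht => (hF t (hG' ht)).2
    obtain ⟨s, hs, ho⟩ := hc G' hG' hGne.of_image
    have hsS : s ⊆ S := by
      obtain ⟨t, ht, hst⟩ := exists_of_odd_degree ho
      exact hst.trans (hG'S t ht)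
    exact ⟨s.image g, by rw [hcard hsS, hs], by rwa [hdeg hG'S hsS]⟩
  · intro s hs h1
    obtain ⟨t, ht, hst⟩ := exists_of_odd_degree (h1 ▸ odd_one : Odd (degree _ s))
    obtain ⟨u, hu, rfl⟩ := mem_image.1 ht
    obtain ⟨s', hs', rfl⟩ := subset_image_iff.1 hst
    have hs'S : s' ⊆ S := Subset.trans hs' (hF u hu).2
    rw [hdeg (fun t ht => (hF t ht).2) hs'S] at h1
    rw [hcard hs'S] at hs
    exact hcon s' hs h1

end Transfer

end SetFamily

/-! ### Homology in terms of set families, and its behaviour under collapses. -/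

namespace FinSimplicialComplex
open Finset SetFamily
open scoped Classical

variable {V : Type*} {K : FinSimplicialComplex V}

theorem mem_faces_of_subset {s t : Finset V} (ht : t ∈ K.faces) (hst : s ⊆ t)
    (hs : s.Nonempty) : s ∈ K.faces :=
  (K.isRelLowerSet_faces ht).2 hst hs

theorem nonempty_of_mem_faces {s : Finset V} (hs : s ∈ K.faces) : s.Nonempty :=
  (K.isRelLowerSet_faces hs).1

/-- `ℤ/2`-acyclicity in terms of families of faces: every cycle is a boundary. -/
def IsCombinatoriallyAcyclic (K : FinSimplicialComplex V) : Prop :=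
  ∀ (n : ℕ) (z : Finset (Finset V)), (∀ s ∈ z, #s = n ∧ (s = ∅ ∨ s ∈ K.faces)) →
    (∀ r, #r + 1 = n → Even (degree z r)) →
    ∃ w : Finset (Finset V), (∀ t ∈ w, #t = n + 1 ∧ t ∈ K.faces) ∧
      ∀ s, #s = n → (s ∈ z ↔ Odd (degree w s))

/-- The set of vertices of an augmented face. -/
def AugFace.carrier {n : ℕ} (s : K.AugFace n) : Finset V := s.1

/-- A set as an augmented face. -/
def AugFace.ofSet {n : ℕ} (s : Finset V) (h : #s = n ∧ (s = ∅ ∨ s ∈ K.faces)) : K.AugFace n :=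
  ⟨s, h⟩

@[simp]
theorem AugFace.carrier_ofSet {n : ℕ} (s : Finset V) (h : #s = n ∧ (s = ∅ ∨ s ∈ K.faces)) :
    (AugFace.ofSet s h).carrier = s := rfl

theorem AugFace.carrier_injective {n : ℕ} :
    Function.Injective (AugFace.carrier : K.AugFace n → Finset V) := Subtype.val_injective

theorem AugFace.card_carrier {n : ℕ} (s : K.AugFace n) : #s.carrier = n := s.2.1

theorem AugFace.carrier_eq_empty_or {n : ℕ} (s : K.AugFace n) :
    s.carrier = ∅ ∨ s.carrier ∈ K.faces := s.2.2

theorem AugFace.carrier_mem_faces {n : ℕ} (s : K.AugFace (n + 1)) : s.carrier ∈ K.faces := by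
  refine s.carrier_eq_empty_or.resolve_left fun he => ?_
  have := s.card_carrier
  rw [he] at this
  simp at this

theorem boundary_single_apply {n : ℕ} (s : K.AugFace (n + 1)) (a : ZMod 2) (u : K.AugFace n) :
    K.boundary n (Finsupp.single s a) u = if u.carrier ⊆ s.carrier then a else 0 := by
  have h1 : K.boundary n (Finsupp.single s a) =
      ∑ v : {v : V // v ∈ s.carrier}, Finsupp.single (s.opposite v) a := by
    rw [boundary, Finsupp.liftAddHom_apply_single, AddMonoidHom.finsetSum_apply]
    rfl
  rw [h1, Finsupp.finsetSum_apply]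
  have h2 : ∀ v : {v : V // v ∈ s.carrier},
      s.opposite v = u ↔ s.carrier.erase v.1 = u.carrier := fun v => Subtype.ext_iff
  simp only [Finsupp.single_apply, h2]
  split_ifs with h
  · obtain ⟨x, hx, hxu⟩ := covBy_iff_exists_insert.1 (covBy_iff_card_sdiff_eq_one.2 ⟨h, by
      rw [card_sdiff_of_subset h, s.card_carrier, u.card_carrier]; omega⟩ :
        u.carrier ⋖ s.carrier)
    rw [sum_eq_single ⟨x, hxu ▸ mem_insert_self x _⟩]
    · rw [if_pos]
      simp [← hxu, hx]
    · intro v _ hv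
      refine if_neg fun hvu => hx ?_
      rw [← hvu, mem_erase]
      exact ⟨fun h => hv (Subtype.ext h.symm), hxu ▸ mem_insert_self x _⟩
    · simp
  · refine sum_eq_zero fun v _ => if_neg fun hv => h ?_
    rw [← hv]
    exact erase_subset _ _

/-- Over ℤ/2 a chain is determined by its support, so boundary coefficients are degrees mod 2. -/
theorem boundary_apply {n : ℕ} (c : K.Chain (n + 1)) (u : K.AugFace n) :
    K.boundary n c u = degree (c.support.image AugFace.carrier) u.carrier := by
  have h1 : K.boundary n c u =
      ∑ s ∈ c.support, if u.carrier ⊆ s.carrier then c s else 0 := by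
    conv_lhs => rw [← c.sum_single, Finsupp.sum, map_sum, Finsupp.finsetSum_apply]
    exact sum_congr rfl fun s _ => boundary_single_apply _ _ _
  have h2 : degree (c.support.image AugFace.carrier) u.carrier =
      #{s ∈ c.support | u.carrier ⊆ s.carrier} := by
    rw [degree, filter_image, card_image_of_injective _ AugFace.carrier_injective]
  rw [h1, h2, card_filter, Nat.cast_sum]
  refine sum_congr rfl fun s hs => ?_
  have h3 : c s = 1 := Fin.eq_one_of_ne_zero _ (Finsupp.mem_support_iff.1 hs)
  split_ifs
  · simpa using h3
  · simp

theorem IsZ2Acyclic.isCombinatoriallyAcyclic (h : K.IsZ2Acyclic) :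
    K.IsCombinatoriallyAcyclic := by
  intro n z hz hcyc
  set zz : Finset (K.AugFace n) := z.attach.image fun s => AugFace.ofSet s.1 (hz s.1 s.2) with hzz
  set c : K.Chain n := Finsupp.indicator zz fun _ _ => 1 with hc
  have hmem : ∀ s : K.AugFace n, s ∈ zz ↔ s.carrier ∈ z := fun s => by
    simp only [hzz, mem_image, mem_attach, true_and]
    constructor
    · rintro ⟨u, rfl⟩
      exact u.2
    · intro hs
      exact ⟨⟨s.carrier, hs⟩, rfl⟩
  have hcs : ∀ s : K.AugFace n, c s = if s.carrier ∈ z then 1 else 0 := fun s => by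
    rw [hc, Finsupp.indicator_apply]
    simp [hmem]
  have hsupp : c.support.image AugFace.carrier = z := by
    ext s
    simp only [mem_image, Finsupp.mem_support_iff, hcs]
    constructor
    · rintro ⟨u, hu, rfl⟩
      simpa using hu
    · intro hs
      exact ⟨AugFace.ofSet s (hz s hs), by
        rw [AugFace.carrier_ofSet, if_pos hs]
        exact one_ne_zero, rfl⟩
  have hcc : c ∈ K.cycles n := by
    cases n with
    | zero => exact AddSubgroup.mem_top _
    | succ n =>
      refine (AddMonoidHom.mem_ker).2 (Finsupp.ext fun u => ?_)
      rw [boundary_apply, hsupp]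
      exact (ZMod.natCast_eq_zero_iff_even).2 (hcyc _ (by rw [u.card_carrier]))
  have h0 : (QuotientAddGroup.mk (⟨c, hcc⟩ : K.cycles n) : K.reducedHomology n) = 0 :=
    (h n).elim _ _
  rw [QuotientAddGroup.eq_zero_iff, AddSubgroup.mem_addSubgroupOf] at h0
  obtain ⟨d, hd⟩ := h0
  refine ⟨d.support.image AugFace.carrier, ?_, ?_⟩
  · intro t ht
    obtain ⟨u, _, rfl⟩ := mem_image.1 ht
    exact ⟨u.card_carrier, u.carrier_mem_faces⟩
  · intro s hs
    by_cases hsK : s = ∅ ∨ s ∈ K.faces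
    · have h1 : K.boundary n d (AugFace.ofSet s ⟨hs, hsK⟩) = c (AugFace.ofSet s ⟨hs, hsK⟩) :=
        DFunLike.congr_fun hd _
      rw [boundary_apply, hcs, AugFace.carrier_ofSet] at h1
      rw [← ZMod.natCast_eq_one_iff_odd, h1]
      simp
    · refine iff_of_false (fun h => hsK (hz s h).2) fun ho => hsK ?_
      obtain ⟨t, ht, hst⟩ := exists_of_odd_degree ho
      obtain ⟨u, _, rfl⟩ := mem_image.1 ht
      rcases s.eq_empty_or_nonempty with he | hne
      · exact Or.inl he
      · exact Or.inr (mem_faces_of_subset u.carrier_mem_faces hst hne)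

theorem IsFree.card_coface {s t : Finset V} (hs : K.IsFree s) (ht : t ∈ K.faces) (hst : s ⊂ t) :
    #t = #s + 1 := by
  obtain ⟨_, t', _, h⟩ := hs
  obtain ⟨x, hxt, hxs⟩ := exists_of_ssubset hst
  have h1 : insert x s ⊆ t := insert_subset hxt hst.subset
  have h2 : insert x s = t :=
    (h _ ⟨mem_faces_of_subset ht h1 (insert_nonempty _ _), ssubset_insert hxs⟩).trans
      (h t ⟨ht, hst⟩).symm
  rw [← h2, card_insert_of_notMem hxs]

/-- A cycle of the smaller complex bounds some w in K, and w can be chosen to avoid the free face s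
and its coface t. If t were in w, then s would have degree 1 and appear in the cycle. If s is in w,
adding the boundary of t removes s without changing the boundary of w. -/
theorem IsCombinatoriallyAcyclic.deleteFace (hK : K.IsCombinatoriallyAcyclic) {s : Finset V}
    (hs : K.IsFree s) : (K.deleteFace s).IsCombinatoriallyAcyclic := by
  obtain ⟨hsK, t, ⟨htK, hst⟩, huniq⟩ := id hs
  have hct := hs.card_coface htK hst
  have hspos : 0 < #s := (nonempty_of_mem_faces hsK).card_pos
  have hmem : ∀ u, u ∈ (K.deleteFace s).faces ↔ u ∈ K.faces ∧ u ≠ s ∧ u ≠ t := fun u => by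
    rw [deleteFace_faces_of_isFree hs htK hst]
    simp
  intro n z hz hcyc
  have hsz : s ∉ z := fun h => by
    rcases (hz s h).2 with h0 | h0
    · simp [h0] at hspos
    · exact ((hmem s).1 h0).2.1 rfl
  obtain ⟨w, hw, hwz⟩ := hK n z
    (fun u hu => ⟨(hz u hu).1, (hz u hu).2.imp_right fun h => ((hmem u).1 h).1⟩) hcyc
  have htw : t ∉ w := by
    intro ht
    have hn : #s = n := by have := (hw t ht).1; omega
    refine hsz ((hwz s hn).2 ?_)
    rw [degree_eq_one_of_unique ht hst.subset]
    · exact odd_one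
    · intro u hu hsu
      refine huniq u ⟨(hw u hu).2, hsu.ssubset_of_ne ?_⟩ |>.trans (huniq t ⟨htK, hst⟩).symm
      rintro rfl
      have := (hw _ hu).1
      omega
  by_cases hsw : s ∈ w
  · have hn : #s = n + 1 := (hw s hsw).1
    refine ⟨symmDiff w (powersetCard (n + 1) t), ?_, ?_⟩
    · intro u hu
      have hcu : #u = n + 1 ∧ u ∈ K.faces := by
        rcases mem_symmDiff.1 hu with h | h
        · exact hw u h.1
        · have h' := mem_powersetCard.1 h.1
          exact ⟨h'.2, mem_faces_of_subset htK h'.1 (card_pos.1 (by omega))⟩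
      refine ⟨hcu.1, (hmem u).2 ⟨hcu.2, ?_, ?_⟩⟩
      · rintro rfl
        rcases mem_symmDiff.1 hu with h | h
        · exact h.2 (mem_powersetCard.2 ⟨hst.subset, hn⟩)
        · exact h.2 hsw
      · rintro rfl
        omega
    · intro r hr
      have he : ¬ Odd (degree (powersetCard (n + 1) t) r) := by
        rw [Nat.not_odd_iff_even]
        by_cases hrt : r ⊆ t
        · have := card_between hrt (by omega)
          rw [hr] at this
          rw [degree, this]
          exact even_two
        · rw [degree, filter_false_of_mem]
          · simp
          · exact fun u hu hru => hrt (hru.trans (mem_powersetCard.1 hu).1)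
      rw [degree_symmDiff, hwz r hr]
      tauto
  · refine ⟨w, fun u hu => ⟨(hw u hu).1, (hmem u).2 ⟨(hw u hu).2, ?_, ?_⟩⟩, hwz⟩
    · rintro rfl; exact hsw hu
    · rintro rfl; exact htw hu

/-! ### Free faces of acyclic complexes, collapsibility and the Morse spectrum. -/

theorem mem_faceFinset {s : Finset V} : s ∈ K.faceFinset ↔ s ∈ K.faces :=
  K.finite_faces.mem_toFinset

theorem card_le_dim_add_one {s : Finset V} (hs : s ∈ K.faces) : #s ≤ K.dim + 1 := by
  have : #s - 1 ≤ K.dim :=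
    le_sup (f := fun s : Finset V => #s - 1) (mem_faceFinset.2 hs)
  omega

theorem mem_topFaces {s : Finset V} : s ∈ K.topFaces ↔ s ∈ K.faces ∧ #s = K.dim + 1 := by
  rw [topFaces, mem_filter, mem_faceFinset]

theorem mem_freeCodimOneFaces {s : Finset V} :
    s ∈ K.freeCodimOneFaces ↔ #s = K.dim ∧ K.IsFree s := by
  rw [freeCodimOneFaces, mem_filter, mem_faceFinset]
  exact ⟨fun h => h.2, fun h => ⟨h.2.1, h⟩⟩

theorem vertices_deleteFace_subset (s : Finset V) : (K.deleteFace s).vertices ⊆ K.vertices :=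
  fun _ hv => hv.1

namespace IsCombinatoriallyAcyclic

theorem faces_ne_empty (hK : K.IsCombinatoriallyAcyclic) : K.faces ≠ ∅ := by
  obtain ⟨w, hw, hwz⟩ := hK 0 {∅} (by simp) (by simp)
  obtain ⟨t, ht, _⟩ := exists_of_odd_degree ((hwz ∅ rfl).1 (mem_singleton_self _))
  exact Set.nonempty_iff_ne_empty.1 ⟨t, (hw t ht).2⟩

theorem hasNoCycle_topFaces (hK : K.IsCombinatoriallyAcyclic) :
    HasNoCycle K.dim K.topFaces := by
  intro G hG hne
  by_contra! hcon
  have hG' := fun s (hs : s ∈ G) => mem_topFaces.1 (hG hs)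
  obtain ⟨w, hw, hwz⟩ := hK (K.dim + 1) G (fun s hs => ⟨(hG' s hs).2, Or.inr (hG' s hs).1⟩)
    fun r hr => Nat.not_odd_iff_even.1 (hcon r (by omega))
  obtain ⟨s, hs⟩ := hne
  obtain ⟨t, ht, _⟩ := exists_of_odd_degree ((hwz s (hG' s hs).2).1 hs)
  have h1 := hw t ht
  have := card_le_dim_add_one h1.2
  omega

theorem freeCodimOneFaces_nonempty (hK : K.IsCombinatoriallyAcyclic)
    (h7 : K.vertices.encard ≤ 7) (hd : K.dim ≠ 0) : K.freeCodimOneFaces.Nonempty := by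
  obtain ⟨k, hk⟩ := Nat.exists_eq_succ_of_ne_zero hd
  have hfin : K.vertices.Finite := Set.finite_of_encard_le_coe h7
  have hS : #hfin.toFinset ≤ 7 := by
    rw [hfin.encard_eq_coe_toFinset_card] at h7
    exact_mod_cast h7
  obtain ⟨s, hs, h1⟩ := exists_degree_eq_one hS (k := k) (F := K.topFaces)
    (fun t ht => by
      have ht' := mem_topFaces.1 ht
      refine ⟨by omega, fun v hv => hfin.mem_toFinset.2 ?_⟩
      exact mem_faces_of_subset ht'.1 (singleton_subset_iff.2 hv) (singleton_nonempty v))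
    (by rw [← Nat.succ_eq_add_one, ← hk]; exact hK.hasNoCycle_topFaces)
    (topFaces_nonempty hK.faces_ne_empty)
  obtain ⟨t, ht⟩ := card_eq_one.1 h1
  have hmem : ∀ u, u ∈ K.topFaces ∧ s ⊆ u ↔ u = t := fun u => by
    rw [← mem_filter, ht, mem_singleton]
  have htt := (hmem t).2 rfl
  have htK := mem_topFaces.1 htt.1
  refine ⟨s, mem_freeCodimOneFaces.2 ⟨by omega,
    mem_faces_of_subset htK.1 htt.2 (card_pos.1 (by omega)), t, ⟨htK.1, ?_⟩, ?_⟩⟩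
  · refine htt.2.ssubset_of_ne ?_
    rintro rfl
    omega
  -- A degree among top faces sees every proper coface of s, because s has codimension one.
  · rintro u ⟨huK, hsu⟩
    refine (hmem u).1 ⟨mem_topFaces.2 ⟨huK, ?_⟩, hsu.subset⟩
    have h2 := card_lt_card hsu
    have h3 := card_le_dim_add_one huK
    omega

theorem isPoint (hK : K.IsCombinatoriallyAcyclic) (hd : K.dim = 0) : K.IsPoint := by
  have hcard : ∀ s ∈ K.faces, #s = 1 := fun s hs => by
    have h1 := card_le_dim_add_one hs
    have h2 := (nonempty_of_mem_faces hs).card_pos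
    omega
  obtain ⟨s, hs⟩ := Set.nonempty_iff_ne_empty.2 hK.faces_ne_empty
  obtain ⟨v, rfl⟩ := card_eq_one.1 (hcard s hs)
  refine ⟨v, Set.eq_singleton_iff_unique_mem.2 ⟨hs, fun u hu => ?_⟩⟩
  by_contra hne
  -- Two distinct vertices form a reduced 0-cycle: the empty set lies in both.
  obtain ⟨x, hx, ho⟩ := hK.hasNoCycle_topFaces {u, {v}} (by
    intro y hy
    rw [mem_topFaces, hd]
    rcases mem_insert.1 hy with rfl | hy
    · exact ⟨hu, hcard _ hu⟩
    · rw [mem_singleton.1 hy]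
      exact ⟨hs, rfl⟩) (insert_nonempty _ _)
  rw [hd, card_eq_zero] at hx
  subst hx
  rw [degree, filter_true_of_mem fun _ _ => empty_subset _, card_pair hne] at ho
  exact Nat.not_even_iff_odd.2 ho even_two

theorem collapsesTo {L : FinSimplicialComplex V} (hK : K.IsCombinatoriallyAcyclic)
    (h : K.CollapsesTo L) : L.IsCombinatoriallyAcyclic ∧ L.vertices ⊆ K.vertices := by
  induction h with
  | refl => exact ⟨hK, subset_rfl⟩
  | tail _ hstep ih =>
    obtain ⟨s, hs, rfl⟩ := hstep
    exact ⟨ih.1.deleteFace hs, (vertices_deleteFace_subset s).trans ih.2⟩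

theorem isCollapsible (hK : K.IsCombinatoriallyAcyclic) (h7 : K.vertices.encard ≤ 7) :
    K.IsCollapsible := by
  induction hn : #K.faceFinset using Nat.strong_induction_on generalizing K with
  | _ n ih =>
    by_cases hd : K.dim = 0
    · exact ⟨K, Relation.ReflTransGen.refl, hK.isPoint hd⟩
    · obtain ⟨s, hs⟩ := hK.freeCodimOneFaces_nonempty h7 hd
      have hs' := (mem_freeCodimOneFaces.1 hs).2
      obtain ⟨L, hL, hpt⟩ := ih _ (hn ▸ card_deleteFace_lt (mem_faceFinset.2 hs'.1))
        (hK.deleteFace hs') ((Set.encard_le_encard (vertices_deleteFace_subset s)).trans h7) rfl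
      exact ⟨L, Relation.ReflTransGen.head ⟨s, hs', rfl⟩ hL, hpt⟩

theorem criticalLaw_eq (hK : K.IsCombinatoriallyAcyclic) (h7 : K.vertices.encard ≤ 7) :
    K.criticalLaw = PMF.pure (Pi.single 0 1) := by
  induction hn : #K.faceFinset using Nat.strong_induction_on generalizing K with
  | _ n ih =>
    rw [criticalLaw, dif_neg hK.faces_ne_empty]
    by_cases hd : K.dim = 0
    -- The complex is a point, and the empty face does not count as free, so the algorithm removes
    -- the vertex as critical and records the single 1 in entry 0.
    · have h1 : ¬ K.freeCodimOneFaces.Nonempty := by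
        rintro ⟨s, hs⟩
        obtain ⟨hs0, hs⟩ := mem_freeCodimOneFaces.1 hs
        rw [hd, card_eq_zero] at hs0
        exact (nonempty_of_mem_faces hs.1).ne_empty hs0
      rw [dif_neg h1]
      obtain ⟨v, hv⟩ := hK.isPoint hd
      have h2 : ∀ s : {s // s ∈ K.topFaces}, (K.deleteFace s.1).criticalLaw = PMF.pure 0 := by
        intro s
        have hs := (mem_topFaces.1 s.2).1
        rw [criticalLaw, dif_pos]
        refine Set.eq_empty_iff_forall_notMem.2 fun u hu => hu.2 ?_
        have hu' := hu.1
        rw [hv, Set.mem_singleton_iff] at hs hu'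
        rw [hs, hu']
      simp only [h2, PMF.pure_map, hd, zero_add, PMF.bind_const]
    · have h1 := hK.freeCodimOneFaces_nonempty h7 hd
      rw [dif_pos h1]
      have h2 : ∀ s : {s // s ∈ K.freeCodimOneFaces},
          (K.deleteFace s.1).criticalLaw = PMF.pure (Pi.single 0 1) := fun s => by
        have hs' := (mem_freeCodimOneFaces.1 s.2).2
        exact ih _ (hn ▸ card_deleteFace_lt (mem_faceFinset.2 hs'.1)) (hK.deleteFace hs')
          ((Set.encard_le_encard (vertices_deleteFace_subset s.1)).trans h7) rfl
      simp only [h2, PMF.bind_const]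

end IsCombinatoriallyAcyclic

theorem tsum_pure_toReal_mul {β : Type*} (b : β) (g : β → ℝ) :
    ∑' c, (PMF.pure b c).toReal * g c = g b := by
  rw [tsum_eq_single b]
  · simp
  · intro c hc
    simp [PMF.pure_apply, hc]

end FinSimplicialComplex

theorem mainTheorem7 {V : Type*} (K : FinSimplicialComplex V)
    (hK : K.IsZ2Acyclic) (h7 : K.vertices.encard ≤ 7) :
    K.IsExtendablyCollapsible ∧
    K.morseSpectrum = PMF.pure (fun i => if i = 0 then 1 else 0) ∧
    K.averageCritical = 1 ∧ K.averageCriticalNormalized = 1 := by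
  have hA := hK.isCombinatoriallyAcyclic
  have hM : K.morseSpectrum = PMF.pure (fun i => if i = 0 then 1 else 0) := by
    rw [FinSimplicialComplex.morseSpectrum, hA.criticalLaw_eq h7, PMF.pure_map]
    congr 1
    funext i
    simp [Pi.single_apply]
  refine ⟨fun L hL => ?_, hM, ?_, ?_⟩
  · obtain ⟨hL1, hL2⟩ := hA.collapsesTo hL
    exact hL1.isCollapsible ((Set.encard_le_encard hL2).trans h7)
  · rw [FinSimplicialComplex.averageCritical, hM, FinSimplicialComplex.tsum_pure_toReal_mul]
    simp
  · rw [FinSimplicialComplex.averageCriticalNormalized,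
      FinSimplicialComplex.normalizedMorseSpectrum, hM, PMF.pure_map,
      FinSimplicialComplex.tsum_pure_toReal_mul]
    have h : ∀ i : Fin (K.dim + 1), FinSimplicialComplex.normalizeVector
        (fun i : Fin (K.dim + 1) => if i = 0 then 1 else 0) i = if i = 0 then 1 else 0 := by
      intro i
      simp only [FinSimplicialComplex.normalizeVector, ← Fin.val_eq_zero_iff]
      split_ifs <;> simp_all
    simp [h]
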